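/- Let $R$ be a commutative Noetherian ring with identity, and let $\mathrm{D}_{\sqsubset}(R)$ be the full subcategory of the derived category of $R$-modules consisting of the complexes $X$ whose homology is left-bounded, i.e. $H_i(X)=0$ for all $i\gg 0$ (homological grading; equivalently, the cohomology of $X$ is bounded below). A subset $\mathcal{Z}\subseteq\operatorname{Spec}R$ is specialization closed if $V(\mathfrak p)\subseteq\mathcal{Z}$ for all $\mathfrak p\in\mathcal{Z}$. For such $\mathcal Z$ and an $R$-module $M$ put $\Gamma_{\mathcal{Z}}(M)=\{x\in M\mid \operatorname{Supp}_R Rx\subseteq\mathcal{Z}\}$, let $\mathbf{R}\Gamma_{\mathcal{Z}}$ be the right derived functor of $\Gamma_{\mathcal{Z}}$ on $\mathrm{D}_{\sqsubset}(R)$, and put $H^i_{\mathcal{Z}}(X)=H_{-i}(\mathbf{R}\Gamma_{\mathcal{Z}}(X))$ for $i\in\mathbb{Z}$. For an ideal $\mathfrak a$ put $H^i_{\mathfrak a}(X)=H^i_{V(\mathfrak a)}(X)$; these notions are used likewise over the localizations $R_{\mathfrak p}$. Let $\mathcal{Z}\subseteq\mathcal{Y}$ be two specialization closed subsets of $\operatorname{Spec}R$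 such that $V(\mathfrak p)\cap(\mathcal{Y}-\mathcal{Z})=\{\mathfrak p\}$ for all $\mathfrak p\in\mathcal{Y}-\mathcal{Z}$. Then for any $X\in\mathrm{D}_{\sqsubset}(R)$ there is a long exact sequence of $R$-modules, with $i$ running over all integers, $$\cdots\to\bigoplus_{\mathfrak p\in\mathcal{Y}-\mathcal{Z}} H^{i-1}_{\mathfrak pR_{\mathfrak p}}(X_{\mathfrak p})\to H^i_{\mathcal{Z}}(X)\to H^i_{\mathcal{Y}}(X)\to\bigoplus_{\mathfrak p\in\mathcal{Y}-\mathcal{Z}} H^i_{\mathfrak pR_{\mathfrak p}}(X_{\mathfrak p})\to H^{i+1}_{\mathcal{Z}}(X)\to\cdots.$$ -/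

import Mathlib

open CategoryTheory
open scoped DirectSum

attribute [local instance] HasDerivedCategory.standard

universe u

namespace SupportedCohomology

variable {R : Type u} [CommRing R]

lemma mem_support_span_singleton_iff {M : Type u} [AddCommGroup M] [Module R M]
    (x : M) (p : PrimeSpectrum R) :
    p ∈ Module.support R (Submodule.span R {x}) ↔ ∀ r : R, r • x = 0 → r ∈ p.asIdeal := by
  rw [Module.mem_support_iff_of_finite]
  simp only [SetLike.le_def]
  exact forall_congr' fun r => imp_congr_left (Submodule.mem_annihilator_span_singleton x r)

/-- The submodule `Γ_Z(M) = {x ∈ M | Supp_R (R x) ⊆ Z}` of `M`. -/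
def sectionsSubmodule (Z : Set (PrimeSpectrum R)) (M : Type u) [AddCommGroup M] [Module R M] :
    Submodule R M where
  carrier := {x | Module.support R (Submodule.span R {x}) ⊆ Z}
  zero_mem' := by
    intro p hp
    rw [mem_support_span_singleton_iff] at hp
    exact absurd (p.asIdeal.eq_top_iff_one.2 (hp 1 (smul_zero 1))) p.isPrime.ne_top
  add_mem' := by
    intro x y hx hy p hp
    rw [mem_support_span_singleton_iff] at hp
    by_contra hpZ
    have h1 : p ∉ Module.support R (Submodule.span R {x}) := fun h => hpZ (hx h)
    have h2 : p ∉ Module.support R (Submodule.span R {y}) := fun h => hpZ (hy h)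
    rw [mem_support_span_singleton_iff] at h1 h2
    push Not at h1 h2
    obtain ⟨a, ha, hap⟩ := h1
    obtain ⟨b, hb, hbp⟩ := h2
    refine p.isPrime.mul_notMem hap hbp (hp (a * b) ?_)
    rw [smul_add, mul_comm, mul_smul, ha, mul_comm, mul_smul, hb, smul_zero, smul_zero, add_zero]
  smul_mem' := by
    intro r x hx p hp
    exact hx (Module.support_subset_of_injective
      (Submodule.inclusion (Submodule.span_singleton_smul_le R r x))
      (Submodule.inclusion_injective _) hp)

lemma map_mem_sectionsSubmodule (Z : Set (PrimeSpectrum R)) {M N : Type u}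
    [AddCommGroup M] [Module R M] [AddCommGroup N] [Module R N] (f : M →ₗ[R] N) {x : M}
    (hx : x ∈ sectionsSubmodule Z M) : f x ∈ sectionsSubmodule Z N := by
  intro p hp
  refine hx ?_
  rw [mem_support_span_singleton_iff] at hp ⊢
  exact fun r hr => hp r (by rw [← map_smul, hr, map_zero])

/-- The functor `Γ_Z` from `R`-modules to `R`-modules: `M ↦ Γ_Z(M)`, and a linear map is
sent to its restriction. -/
def sectionsFunctor (Z : Set (PrimeSpectrum R)) : ModuleCat.{u} R ⥤ ModuleCat.{u} R where
  obj M := ModuleCat.of R (sectionsSubmodule Z M)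
  map f := ModuleCat.ofHom (f.hom.restrict fun _ hx => map_mem_sectionsSubmodule Z f.hom hx)

instance (Z : Set (PrimeSpectrum R)) : (sectionsFunctor Z).Additive where

/-- The local cohomology module `H^i_Z(X)` of a complex `X` in `D_⊏(R)` with support in `Z`: the
cohomology in degree `i` (homology in degree `-i`) of `RΓ_Z(X)`, where `RΓ_Z` is the right derived
functor of `Γ_Z`. `DerivedCategory.Plus` is the derived category of the cohomologically bounded
below complexes, that is, the complexes whose homology vanishes in all large homological
degrees. -/
noncomputable def localCohomology (Z : Set (PrimeSpectrum R)) (i : ℤ)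
    (X : DerivedCategory.Plus (ModuleCat.{u} R)) : ModuleCat.{u} R :=
  (DerivedCategory.Plus.homologyFunctor (ModuleCat.{u} R) i).obj
    ((sectionsFunctor Z).rightDerivedFunctorPlus.obj X)

/-- `H^i_𝔞(X)` for an ideal `𝔞`: local cohomology with support in the closed set `V(𝔞)`. -/
noncomputable def localCohomologyIdeal (I : Ideal R) (i : ℤ)
    (X : DerivedCategory.Plus (ModuleCat.{u} R)) : ModuleCat.{u} R :=
  localCohomology (PrimeSpectrum.zeroLocus (I : Set R)) i X

/-- The functor `D_⊏(R) ⥤ D_⊏(R_𝔭)`, `X ↦ X_𝔭`, induced by the exact localization functor. -/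
noncomputable def localizationFunctor (p : PrimeSpectrum R) :
    DerivedCategory.Plus (ModuleCat.{u} R) ⥤
      DerivedCategory.Plus (ModuleCat.{u} (Localization.AtPrime p.asIdeal)) :=
  DerivedCategory.TStructure.t.plus.lift
    (DerivedCategory.Plus.ι ⋙
      (ModuleCat.localizedModuleFunctor.{u} p.asIdeal.primeCompl).mapDerivedCategory) (by
    rintro ⟨X, n, K, e, h⟩
    refine ⟨n, ((ModuleCat.localizedModuleFunctor.{u} p.asIdeal.primeCompl).mapHomologicalComplex
      (ComplexShape.up ℤ)).obj K, ?_, inferInstance⟩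
    exact (ModuleCat.localizedModuleFunctor.{u} p.asIdeal.primeCompl).mapDerivedCategory.mapIso e ≪≫
      (ModuleCat.localizedModuleFunctor.{u}
        p.asIdeal.primeCompl).mapDerivedCategoryFactors.app K)

/-- `H^i_{𝔭 R_𝔭}(X_𝔭)`, regarded as an `R`-module by restriction of scalars. -/
noncomputable def localCohomologyAtPrime (p : PrimeSpectrum R) (i : ℤ)
    (X : DerivedCategory.Plus (ModuleCat.{u} R)) : ModuleCat.{u} R :=
  (ModuleCat.restrictScalars (algebraMap R (Localization.AtPrime p.asIdeal))).obj
    (localCohomologyIdeal (p.asIdeal.map (algebraMap R (Localization.AtPrime p.asIdeal))) i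
      ((localizationFunctor p).obj X))

end SupportedCohomology

namespace SupportedCohomology

variable {R : Type u} [CommRing R]

/-! The long exact sequence is the homology sequence of 0 → Γ_Z(I) → Γ_Y(I) → ⨁ Γ_{pR_p}(I_p) → 0,
where I is a bounded below complex of injectives representing X and p runs over Y \ Z. The
hypothesis on Y \ Z makes its points minimal in Y. Hence an element of Γ_Y(M) becomes pR_p-torsion
in M_p (`map_mem_sectionsSubmodule_localization`) and is nonzero in only finitely many M_p
(`finite_support_sdiff`), so the right-hand map lands in the direct sum. Its kernel is Γ_Z(M)
because M_p detects whether p is in the support. Only surjectivity needs M injective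
(`exists_lift_of_injective`). The homology of the third term is the stated sum because direct sums
and restriction of scalars are exact, and localization over a Noetherian ring is exact and preserves
injectives. -/

lemma mem_sectionsSubmodule_iff {Z : Set (PrimeSpectrum R)} {M : Type u} [AddCommGroup M]
    [Module R M] {x : M} :
    x ∈ sectionsSubmodule Z M ↔
      ∀ p : PrimeSpectrum R, (∀ r : R, r • x = 0 → r ∈ p.asIdeal) → p ∈ Z :=
  forall_congr' fun p => imp_congr_left (mem_support_span_singleton_iff x p)

lemma sectionsSubmodule_mono {Z Y : Set (PrimeSpectrum R)} (h : Z ⊆ Y) (M : Type u)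
    [AddCommGroup M] [Module R M] : sectionsSubmodule Z M ≤ sectionsSubmodule Y M :=
  fun _ hx => Set.Subset.trans hx h

/-! ### Supports, localization and lifting of torsion elements -/

section Algebra

variable {Z Y : Set (PrimeSpectrum R)}

/-- Points of Y \ Z are minimal in Y: if q were in Z then so would be p, hence p lies in V(q) ∩ (Y \
Z) = {q}. -/
lemma eq_of_le_of_mem_sdiff (hZ : StableUnderSpecialization Z)
    (hmin : ∀ p ∈ Y \ Z, PrimeSpectrum.zeroLocus (p.asIdeal : Set R) ∩ (Y \ Z) = {p})
    {p q : PrimeSpectrum R} (hp : p ∈ Y \ Z) (hq : q ∈ Y) (hqp : q ≤ p) : q = p := by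
  have hqZ : q ∉ Z := fun h => hp.2 (hZ ((PrimeSpectrum.le_iff_specializes q p).1 hqp) h)
  have : p ∈ PrimeSpectrum.zeroLocus (q.asIdeal : Set R) ∩ (Y \ Z) := ⟨hqp, hp⟩
  rw [hmin q ⟨hq, hqZ⟩] at this
  exact this.symm

variable {M : Type u} [AddCommGroup M] [Module R M]

/-- A prime in the support of the image contracts to some q ≤ p in Y, and minimality forces q = p.
-/
lemma map_mem_sectionsSubmodule_localization (hZ : StableUnderSpecialization Z)
    (hmin : ∀ p ∈ Y \ Z, PrimeSpectrum.zeroLocus (p.asIdeal : Set R) ∩ (Y \ Z) = {p})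
    {p : PrimeSpectrum R} (hp : p ∈ Y \ Z)
    {N : Type u} [AddCommGroup N] [Module R N] [Module (Localization.AtPrime p.asIdeal) N]
    [IsScalarTower R (Localization.AtPrime p.asIdeal) N] (f : M →ₗ[R] N)
    {x : M} (hx : x ∈ sectionsSubmodule Y M) :
    f x ∈ sectionsSubmodule (PrimeSpectrum.zeroLocus
      (p.asIdeal.map (algebraMap R (Localization.AtPrime p.asIdeal)) :
        Set (Localization.AtPrime p.asIdeal))) N := by
  rw [mem_sectionsSubmodule_iff] at hx ⊢
  intro P hP
  set q : PrimeSpectrum R := PrimeSpectrum.comap (algebraMap R _) P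
  have hqY : q ∈ Y := hx q fun r hr =>
    hP _ (by rw [algebraMap_smul, ← map_smul, hr, map_zero])
  have hqp : q ≤ p := by
    have := IsLocalization.disjoint_under_iff p.asIdeal.primeCompl
      (Localization.AtPrime p.asIdeal) P.asIdeal |>.2 P.isPrime.ne_top
    intro r hr
    by_contra h
    exact Set.disjoint_left.1 this h hr
  have hq := eq_of_le_of_mem_sdiff hZ hmin hp hqY hqp
  rw [PrimeSpectrum.mem_zeroLocus, SetLike.coe_subset_coe, Ideal.map_le_iff_le_comap]
  exact (congrArg PrimeSpectrum.asIdeal hq).ge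

/-- By minimality in Y, these primes are minimal over the annihilator of x, and a Noetherian ring
has finitely many such primes. -/
lemma finite_support_sdiff [IsNoetherianRing R] (hZ : StableUnderSpecialization Z)
    (hmin : ∀ p ∈ Y \ Z, PrimeSpectrum.zeroLocus (p.asIdeal : Set R) ∩ (Y \ Z) = {p})
    {x : M} (hx : x ∈ sectionsSubmodule Y M) :
    {p : ↥(Y \ Z) | ∀ r : R, r • x = 0 → r ∈ p.1.asIdeal}.Finite := by
  refine Set.Finite.of_finite_image (f := fun p => p.1.asIdeal)
    ((Ideal.finite_minimalPrimes_of_isNoetherianRing R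
      (Submodule.span R {x}).annihilator).subset ?_) ?_
  · rintro _ ⟨p, hp, rfl⟩
    refine ⟨⟨p.1.isPrime, fun r hr =>
      hp r ((Submodule.mem_annihilator_span_singleton x r).1 hr)⟩, fun q ⟨hq, hxq⟩ hqp => ?_⟩
    have hqY : (⟨q, hq⟩ : PrimeSpectrum R) ∈ Y := mem_sectionsSubmodule_iff.1 hx _ fun r hr =>
      hxq ((Submodule.mem_annihilator_span_singleton x r).2 hr)
    exact (congrArg PrimeSpectrum.asIdeal (eq_of_le_of_mem_sdiff hZ hmin p.2 hqY hqp)).ge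
  · intro p _ q _ h
    exact Subtype.ext (PrimeSpectrum.ext h)

lemma localization_apply_ne_zero_iff {p : PrimeSpectrum R} {N : Type u} [AddCommGroup N]
    [Module R N] (f : M →ₗ[R] N) [IsLocalizedModule p.asIdeal.primeCompl f] (x : M) :
    f x ≠ 0 ↔ ∀ r : R, r • x = 0 → r ∈ p.asIdeal := by
  rw [Ne, IsLocalizedModule.eq_zero_iff p.asIdeal.primeCompl f]
  push Not
  constructor
  · intro h r hr
    by_contra hrp
    exact h ⟨r, hrp⟩ hr
  · intro h c hc
    exact c.2 (h c hc)

lemma exists_pow_smul_eq_zero {S : Type u} [CommRing S] {I : Ideal S} {N : Type u}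
    [AddCommGroup N] [Module S N] {y : N}
    (hy : y ∈ sectionsSubmodule (PrimeSpectrum.zeroLocus (I : Set S)) N) {a : S} (ha : a ∈ I) :
    ∃ n : ℕ, a ^ n • y = 0 := by
  have : a ∈ (Submodule.span S {y}).annihilator.radical := by
    rw [Ideal.radical_eq_sInf, Ideal.mem_sInf]
    intro P hP
    exact (mem_sectionsSubmodule_iff.1 hy ⟨P, hP.2⟩ fun r hr =>
      hP.1 ((Submodule.mem_annihilator_span_singleton y r).2 hr)) ha
  obtain ⟨n, hn⟩ := this
  exact ⟨n, (Submodule.mem_annihilator_span_singleton y _).1 hn⟩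

/-- With J = ann(y), write y = x / s where J kills x. Injectivity of M then divides x by s without
losing annihilation by J, and the quotient is the lift. -/
lemma exists_lift_of_injective [IsNoetherianRing R] [Module.Injective R M]
    (p : PrimeSpectrum R)
    {N : Type u} [AddCommGroup N] [Module R N] [Module (Localization.AtPrime p.asIdeal) N]
    [IsScalarTower R (Localization.AtPrime p.asIdeal) N] (f : M →ₗ[R] N)
    [IsLocalizedModule p.asIdeal.primeCompl f] {y : N}
    (hy : y ∈ sectionsSubmodule (PrimeSpectrum.zeroLocus
      (p.asIdeal.map (algebraMap R (Localization.AtPrime p.asIdeal)) :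
        Set (Localization.AtPrime p.asIdeal))) N) :
    ∃ x ∈ sectionsSubmodule (PrimeSpectrum.zeroLocus (p.asIdeal : Set R)) M, f x = y := by
  set J : Ideal R := LinearMap.ker (LinearMap.toSpanSingleton R N y) with hJ
  have memJ (r : R) : r ∈ J ↔ r • y = 0 := by simp [hJ]
  obtain ⟨⟨x₀, s₀⟩, hx₀⟩ := IsLocalizedModule.surj p.asIdeal.primeCompl f y
  -- Each generator of J kills x₀ up to a denominator; as J is finitely generated, one product of
  -- denominators serves for all of J.
  obtain ⟨t, ht⟩ : ∃ t : p.asIdeal.primeCompl, ∀ j ∈ J, t • j • x₀ = 0 := by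
    obtain ⟨T, hT⟩ := (IsNoetherian.noetherian J : J.FG)
    have h0 (j : R) (hj : j ∈ T) : ∃ c : p.asIdeal.primeCompl, c • j • x₀ = 0 := by
      rw [← IsLocalizedModule.eq_zero_iff p.asIdeal.primeCompl f, map_smul, ← hx₀,
        smul_comm, (memJ j).1 (hT ▸ Submodule.subset_span hj), smul_zero]
    choose! c hc using h0
    refine ⟨∏ j ∈ T, c j, fun j hj => ?_⟩
    let K : Ideal R := LinearMap.ker
      (LinearMap.toSpanSingleton R M ((∏ j ∈ T, c j) • x₀))
    have hK : J ≤ K := by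
      rw [← hT, Submodule.span_le]
      intro j hj
      have : j • (∏ j ∈ T, c j) • x₀ = 0 := by
        classical
        rw [smul_comm, ← Finset.prod_erase_mul T c hj, mul_smul, hc j hj, smul_zero]
      simpa [K] using this
    have : j • (∏ j ∈ T, c j) • x₀ = 0 := by simpa [K] using hK hj
    rwa [smul_comm]
  set x := t • x₀ with hx
  set s := t * s₀ with hs
  have hsy : s • y = f x := by
    rw [hs, mul_smul, hx₀, hx, Submonoid.smul_def, Submonoid.smul_def, map_smul]
  have hJx : J ≤ LinearMap.ker (LinearMap.toSpanSingleton R M x) := fun j hj => by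
    have := ht j hj
    rw [smul_comm] at this
    simpa [hx] using this
  let μ : (R ⧸ J) →ₗ[R] (R ⧸ J) := LinearMap.lsmul R (R ⧸ J) (s : R)
  -- R/J embeds in N as Ry, and s acts injectively on N.
  have hμ : Function.Injective μ := by
    rw [← LinearMap.ker_eq_bot, LinearMap.ker_eq_bot']
    intro r
    obtain ⟨r, rfl⟩ := Submodule.Quotient.mk_surjective J r
    intro h
    have h1 : (s : R) • r ∈ J := by
      rwa [← Submodule.Quotient.mk_eq_zero, Submodule.Quotient.mk_smul]
    rw [Submodule.Quotient.mk_eq_zero, memJ]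
    rw [memJ, smul_assoc] at h1
    exact IsLocalizedModule.smul_injective f s (h1.trans (smul_zero s).symm)
  -- Extending 1 ↦ x along multiplication by s gives h with s • h(1) = x.
  obtain ⟨h, hh⟩ := Module.Injective.out μ hμ (J.liftQ _ hJx)
  let o : R ⧸ J := Submodule.Quotient.mk 1
  have hann (r : R) (hr : r ∈ J) : r • h o = 0 := by
    rw [← map_smul, ← Submodule.Quotient.mk_smul, smul_eq_mul, mul_one,
      (Submodule.Quotient.mk_eq_zero J).2 hr, map_zero]
  have hsx : s • h o = x := by
    have := hh o
    simp only [μ, LinearMap.lsmul_apply, map_smul] at this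
    rw [Submonoid.smul_def, this]
    exact one_smul R x
  refine ⟨h o, mem_sectionsSubmodule_iff.2 fun q hq a ha => ?_, ?_⟩
  -- A power of each a ∈ p kills y, so lies in J, which kills h(1).
  · obtain ⟨n, hn⟩ := exists_pow_smul_eq_zero hy (Ideal.mem_map_of_mem _ ha)
    rw [← map_pow, algebraMap_smul, ← memJ] at hn
    exact q.isPrime.mem_of_pow_mem n (hq _ (hann _ hn))
  · apply IsLocalizedModule.smul_injective f s
    change s • f (h o) = s • y
    rw [hsy, ← hsx, Submonoid.smul_def, Submonoid.smul_def, map_smul]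

end Algebra

/-- The functor `M ↦ Γ_{V(𝔭 R_𝔭)}(M_𝔭)`, regarded as an `R`-module. -/
noncomputable def localSectionsFunctor (p : PrimeSpectrum R) :
    ModuleCat.{u} R ⥤ ModuleCat.{u} R :=
  ModuleCat.localizedModuleFunctor.{u} p.asIdeal.primeCompl ⋙
    sectionsFunctor (PrimeSpectrum.zeroLocus
      (p.asIdeal.map (algebraMap R (Localization.AtPrime p.asIdeal)) :
        Set (Localization.AtPrime p.asIdeal))) ⋙
    ModuleCat.restrictScalars (algebraMap R (Localization.AtPrime p.asIdeal))

instance (p : PrimeSpectrum R) : (localSectionsFunctor p).Additive := by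
  unfold localSectionsFunctor; infer_instance

/-- The family of functors `localSectionsFunctor p`, for `p` in a set of primes. -/
noncomputable def localSectionsFamily (T : Set (PrimeSpectrum R)) :
    ModuleCat.{u} R ⥤ (Discrete T ⥤ ModuleCat.{u} R) :=
  (Discrete.functor fun p : T => localSectionsFunctor p.1).flip

instance (T : Set (PrimeSpectrum R)) : (localSectionsFamily T).Additive where
  map_add {X Y f g} := by
    ext ⟨p⟩ : 2
    exact (localSectionsFunctor p.1).map_add

/-- The direct sum of a family of modules, as a functor. -/
noncomputable def directSumFunctor (J : Type u) :
    (Discrete J ⥤ ModuleCat.{u} R) ⥤ ModuleCat.{u} R where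
  obj F := ModuleCat.of R (⨁ j : J, F.obj ⟨j⟩)
  map f := ModuleCat.ofHom (DirectSum.lmap fun j => (f.app ⟨j⟩).hom)
  map_id F := by
    ext : 1
    exact DirectSum.lmap_id
  map_comp f g := by
    ext x
    rfl

instance (J : Type u) : (directSumFunctor (R := R) J).Additive where
  map_add {X Y f g} := by
    ext x
    exact DFinsupp.ext fun j => rfl

/-- Preimages are chosen componentwise, and kept only on the support of b so that they form an
element of the direct sum. -/
lemma directSum_lmap_exact {J : Type u} {A B C : J → Type u}
    [∀ j, AddCommGroup (A j)] [∀ j, Module R (A j)]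
    [∀ j, AddCommGroup (B j)] [∀ j, Module R (B j)]
    [∀ j, AddCommGroup (C j)] [∀ j, Module R (C j)]
    (f : ∀ j, A j →ₗ[R] B j) (g : ∀ j, B j →ₗ[R] C j) (h : ∀ j, Function.Exact (f j) (g j)) :
    Function.Exact (DirectSum.lmap f) (DirectSum.lmap g) := by
  classical
  intro b
  constructor
  · intro hb
    have hb' (j : J) : ∃ a, f j a = b j := (h j _).1 (DFunLike.congr_fun hb j)
    choose a ha using hb'
    refine ⟨DirectSum.mk A (DFinsupp.support b) fun j => a j, ?_⟩
    ext j
    rw [DirectSum.lmap_apply]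
    by_cases hj : j ∈ DFinsupp.support b
    · rw [DirectSum.mk_apply_of_mem hj]
      exact ha j
    · rw [DirectSum.mk_apply_of_notMem hj, map_zero]
      exact (DFinsupp.notMem_support_iff.1 hj).symm
  · rintro ⟨a, rfl⟩
    ext j
    simp only [DirectSum.lmap_apply, DirectSum.zero_apply]
    exact (h j).apply_apply_eq_zero _

lemma directSumFunctor_map_exact (J : Type u) (S : ShortComplex (Discrete J ⥤ ModuleCat.{u} R))
    (hS : S.Exact) : (S.map (directSumFunctor J)).Exact := by
  rw [ShortComplex.ShortExact.moduleCat_exact_iff_function_exact]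
  refine directSum_lmap_exact (fun j => (S.f.app ⟨j⟩).hom) (fun j => (S.g.app ⟨j⟩).hom) fun j => ?_
  exact (ShortComplex.ShortExact.moduleCat_exact_iff_function_exact _).1
    (hS.map ((evaluation (Discrete J) (ModuleCat.{u} R)).obj ⟨j⟩))

instance (J : Type u) : Limits.PreservesFiniteLimits (directSumFunctor (R := R) J) :=
  ((Functor.exact_tfae (directSumFunctor (R := R) J)).out 1 3 rfl rfl |>.1
    (directSumFunctor_map_exact J)).1

instance (J : Type u) : Limits.PreservesFiniteColimits (directSumFunctor (R := R) J) :=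
  ((Functor.exact_tfae (directSumFunctor (R := R) J)).out 1 3 rfl rfl |>.1
    (directSumFunctor_map_exact J)).2

/-! ### The short exact sequence on injective modules -/

section

variable {Z Y : Set (PrimeSpectrum R)}

/-- The inclusion `Γ_Z ⟶ Γ_Y` for `Z ⊆ Y`. -/
def sectionsInclusion (h : Z ⊆ Y) : sectionsFunctor Z ⟶ sectionsFunctor Y where
  app M := ModuleCat.ofHom (Submodule.inclusion (sectionsSubmodule_mono h M))

variable (hZ : StableUnderSpecialization Z)
  (hmin : ∀ p ∈ Y \ Z, PrimeSpectrum.zeroLocus (p.asIdeal : Set R) ∩ (Y \ Z) = {p})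

/-- The map `Γ_Y(M) → Γ_{V(𝔭 R_𝔭)}(M_𝔭)` induced by localization. -/
noncomputable def sectionsToLocal (M : ModuleCat.{u} R) (p : ↥(Y \ Z)) :
    sectionsSubmodule Y M →ₗ[R] (localSectionsFunctor p.1).obj M where
  toFun x := ⟨M.localizedModuleMkLinearMap p.1.asIdeal.primeCompl x,
    map_mem_sectionsSubmodule_localization hZ hmin p.2
      (N := M.localizedModule p.1.asIdeal.primeCompl) _ x.2⟩
  map_add' x y := Subtype.ext (map_add (M.localizedModuleMkLinearMap _) x.1 y.1)
  map_smul' r x := Subtype.ext ((map_smul (M.localizedModuleMkLinearMap _) r x.1).trans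
    (algebraMap_smul (Localization p.1.asIdeal.primeCompl) r _).symm)

lemma sectionsToLocal_eq_zero_iff (M : ModuleCat.{u} R) (p : ↥(Y \ Z))
    (x : sectionsSubmodule Y M) : sectionsToLocal hZ hmin M p x = 0 ↔
      M.localizedModuleMkLinearMap p.1.asIdeal.primeCompl x = 0 :=
  Subtype.ext_iff

variable [IsNoetherianRing R]

lemma sectionsToLocal_mem_range (M : ModuleCat.{u} R) (x : sectionsSubmodule Y M) :
    LinearMap.pi (sectionsToLocal hZ hmin M) x ∈
      LinearMap.range (DFinsupp.coeFnLinearMap R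
        (β := fun p : ↥(Y \ Z) => (localSectionsFunctor p.1).obj M)) := by
  classical
  have hfin := finite_support_sdiff hZ hmin x.2
  refine ⟨DFinsupp.mk hfin.toFinset fun p => sectionsToLocal hZ hmin M p.1 x, ?_⟩
  ext p : 1
  rw [DFinsupp.coeFnLinearMap_apply, DFinsupp.mk_apply, LinearMap.pi_apply]
  split_ifs with hp
  · rfl
  · rw [Set.Finite.mem_toFinset, Set.mem_ofPred_eq, ← localization_apply_ne_zero_iff
      (M.localizedModuleMkLinearMap p.1.asIdeal.primeCompl), not_not] at hp
    exact ((sectionsToLocal_eq_zero_iff hZ hmin M p x).2 hp).symm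

/-- The map `Γ_Y(M) → ⨁ Γ_{V(𝔭 R_𝔭)}(M_𝔭)`, the sum being over the primes in `Y \ Z`. -/
noncomputable def sectionsToDirectSum (M : ModuleCat.{u} R) :
    sectionsSubmodule Y M →ₗ[R] ⨁ p : ↥(Y \ Z), (localSectionsFunctor p.1).obj M :=
  (LinearEquiv.ofInjective (DFinsupp.coeFnLinearMap R
    (β := fun p : ↥(Y \ Z) => (localSectionsFunctor p.1).obj M)) DFunLike.coe_injective).symm.comp
    (LinearMap.codRestrict _ (LinearMap.pi (sectionsToLocal hZ hmin M))
      (sectionsToLocal_mem_range hZ hmin M))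

lemma sectionsToDirectSum_apply (M : ModuleCat.{u} R) (x : sectionsSubmodule Y M)
    (p : ↥(Y \ Z)) : sectionsToDirectSum hZ hmin M x p = sectionsToLocal hZ hmin M p x := by
  have := LinearEquiv.ofInjective_symm_apply (f := DFinsupp.coeFnLinearMap R
    (β := fun p : ↥(Y \ Z) => (localSectionsFunctor p.1).obj M)) (h := DFunLike.coe_injective)
    (LinearMap.codRestrict _ (LinearMap.pi (sectionsToLocal hZ hmin M))
      (sectionsToLocal_mem_range hZ hmin M) x)
  exact congrFun this p

lemma sectionsToDirectSum_eq_zero_iff (M : ModuleCat.{u} R) (x : sectionsSubmodule Y M) :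
    sectionsToDirectSum hZ hmin M x = 0 ↔ (x : M) ∈ sectionsSubmodule Z M := by
  have h1 : sectionsToDirectSum hZ hmin M x = 0 ↔ ∀ p : ↥(Y \ Z),
      M.localizedModuleMkLinearMap p.1.asIdeal.primeCompl x = 0 := by
    rw [DFinsupp.ext_iff]
    refine forall_congr' fun p => ?_
    rw [← sectionsToLocal_eq_zero_iff hZ hmin, ← sectionsToDirectSum_apply]
    rfl
  rw [h1, mem_sectionsSubmodule_iff]
  constructor
  · intro h p hp
    by_contra hpZ
    exact (localization_apply_ne_zero_iff (M.localizedModuleMkLinearMap p.asIdeal.primeCompl)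
      (x : M)).2 hp (h ⟨p, mem_sectionsSubmodule_iff.1 x.2 p hp, hpZ⟩)
  · intro h p
    by_contra hp
    exact p.2.2 (h p.1 ((localization_apply_ne_zero_iff _ _).1 hp))

lemma sectionsToDirectSum_surjective (hY : StableUnderSpecialization Y) (M : ModuleCat.{u} R)
    [Module.Injective R M] : Function.Surjective (sectionsToDirectSum hZ hmin M) := by
  classical
  rw [← LinearMap.range_eq_top, eq_top_iff]
  rintro y -
  induction y using DirectSum.induction_on with
  | zero => exact zero_mem _
  | add a b ha hb => exact add_mem ha hb
  | of p y =>
    obtain ⟨x, hx, hxy⟩ := exists_lift_of_injective p.1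
      (M.localizedModuleMkLinearMap p.1.asIdeal.primeCompl)
      (show y.1 ∈ sectionsSubmodule _ (M.localizedModule p.1.asIdeal.primeCompl) from y.2)
    have hxY : x ∈ sectionsSubmodule Y M := by
      refine sectionsSubmodule_mono (fun q hq => ?_) M hx
      exact hY ((PrimeSpectrum.le_iff_specializes p.1 q).1 hq) p.2.1
    refine ⟨⟨x, hxY⟩, DFinsupp.ext fun q => ?_⟩
    refine (sectionsToDirectSum_apply hZ hmin M _ q).trans ?_
    by_cases hq : q = p
    · subst hq
      exact (Subtype.ext hxy).trans (DirectSum.of_eq_same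
        (β := fun p : ↥(Y \ Z) => (localSectionsFunctor p.1).obj M) q y).symm
    · refine Eq.trans ?_ (DirectSum.of_eq_of_ne
        (β := fun p : ↥(Y \ Z) => (localSectionsFunctor p.1).obj M) p q y hq).symm
      rw [sectionsToLocal_eq_zero_iff]
      by_contra h0
      -- The lift is supported in V(p), which meets Y \ Z only in p, so its components at all other
      -- q vanish.
      have hqp : q.1 ∈ PrimeSpectrum.zeroLocus (p.1.asIdeal : Set R) :=
        mem_sectionsSubmodule_iff.1 hx _ ((localization_apply_ne_zero_iff _ _).1 h0)
      have : q.1 ∈ PrimeSpectrum.zeroLocus (p.1.asIdeal : Set R) ∩ (Y \ Z) := ⟨hqp, q.2⟩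
      rw [hmin p.1 p.2] at this
      exact hq (Subtype.ext this)

/-- The natural map `Γ_Y(M) → ⨁ Γ_{V(𝔭 R_𝔭)}(M_𝔭)`. -/
noncomputable def sectionsToDirectSumNatTrans :
    sectionsFunctor Y ⟶ localSectionsFamily (Y \ Z) ⋙ directSumFunctor ↥(Y \ Z) where
  app M := ModuleCat.ofHom (sectionsToDirectSum hZ hmin M)
  naturality M N f := by
    ext x
    refine DFinsupp.ext fun p => ?_
    refine (sectionsToDirectSum_apply hZ hmin N _ p).trans (Eq.trans ?_
      (DirectSum.lmap_apply (fun p : ↥(Y \ Z) => ((localSectionsFunctor p.1).map f).hom) _ p).symm)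
    refine Eq.trans ?_ (congrArg ((localSectionsFunctor p.1).map f).hom
      (sectionsToDirectSum_apply hZ hmin M x p)).symm
    refine Subtype.ext ?_
    exact (IsLocalizedModule.map_apply p.1.asIdeal.primeCompl
      (M.localizedModuleMkLinearMap p.1.asIdeal.primeCompl)
      (N.localizedModuleMkLinearMap p.1.asIdeal.primeCompl) f.hom x.1).symm

/-- The complex `Γ_Z ⟶ Γ_Y ⟶ ⨁ Γ_{V(𝔭 R_𝔭)}((-)_𝔭)` of functors. -/
noncomputable def sectionsShortComplex (hZY : Z ⊆ Y) :
    ShortComplex (ModuleCat.{u} R ⥤ ModuleCat.{u} R) where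
  f := sectionsInclusion hZY
  g := sectionsToDirectSumNatTrans hZ hmin
  zero := by
    ext M x
    exact (sectionsToDirectSum_eq_zero_iff hZ hmin M _).2 x.2

lemma sectionsShortComplex_shortExact (hY : StableUnderSpecialization Y) (hZY : Z ⊆ Y)
    (M : ModuleCat.{u} R) [Injective M] :
    ((sectionsShortComplex hZ hmin hZY).map ((evaluation _ _).obj M)).ShortExact := by
  have : Module.Injective R M := Module.injective_module_of_injective_object R M
  refine { exact := ?_, mono_f := ?_, epi_g := ?_ }
  · rw [ShortComplex.ShortExact.moduleCat_exact_iff_function_exact]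
    intro x
    refine (sectionsToDirectSum_eq_zero_iff hZ hmin M x).trans ⟨fun hx => ?_, ?_⟩
    · exact ⟨⟨x.1, hx⟩, rfl⟩
    · rintro ⟨z, rfl⟩
      exact z.2
  · exact (ModuleCat.mono_iff_injective _).2
      (Submodule.inclusion_injective (sectionsSubmodule_mono hZY M))
  · exact (ModuleCat.epi_iff_surjective _).2 (sectionsToDirectSum_surjective hZ hmin hY M)

end

/-! ### Computing the three terms on an injective resolution -/

lemma nonempty_localCohomology_iso (Z : Set (PrimeSpectrum R)) (i : ℤ)
    {X : DerivedCategory.Plus (ModuleCat.{u} R)}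
    (L : CochainComplex.Plus (InjectiveObject (ModuleCat.{u} R)))
    (e : DerivedCategory.Plus.Q.obj
      ((InjectiveObject.ι (ModuleCat.{u} R)).mapCochainComplexPlus.obj L) ≅ X) :
    Nonempty (localCohomology Z i X ≅ (((sectionsFunctor Z).mapHomologicalComplex _).obj
      (((InjectiveObject.ι (ModuleCat.{u} R)).mapHomologicalComplex _).obj L.obj)).homology i) := by
  -- The unit of the right derived functor is invertible on bounded below complexes of injectives.
  let e₁ := asIso ((sectionsFunctor Z).rightDerivedFunctorPlusUnit.app
    ((HomotopyCategory.Plus.quotient (ModuleCat.{u} R)).obj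
      ((InjectiveObject.ι (ModuleCat.{u} R)).mapCochainComplexPlus.obj L)))
  let e₂ := (DerivedCategory.Plus.homologyFunctor (ModuleCat.{u} R) i).mapIso
    (e₁ ≪≫ (sectionsFunctor Z).rightDerivedFunctorPlus.mapIso e)
  let e₃ := (DerivedCategory.homologyFunctorFactorsh (ModuleCat.{u} R) i ≪≫ Iso.refl _).app
    ((HomotopyCategory.quotient _ _).obj (((sectionsFunctor Z).mapHomologicalComplex _).obj
      (((InjectiveObject.ι (ModuleCat.{u} R)).mapHomologicalComplex _).obj L.obj)))
  let e₄ := (HomotopyCategory.homologyFunctorFactors (ModuleCat.{u} R) (ComplexShape.up ℤ) i).app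
    (((sectionsFunctor Z).mapHomologicalComplex _).obj
      (((InjectiveObject.ι (ModuleCat.{u} R)).mapHomologicalComplex _).obj L.obj))
  exact ⟨e₂.symm ≪≫ e₃ ≪≫ e₄⟩

lemma injective_localizedModuleFunctor_obj [IsNoetherianRing R] (S : Submonoid R)
    (M : ModuleCat.{u} R) [Injective M] :
    Injective ((ModuleCat.localizedModuleFunctor.{u} S).obj M) := by
  have := Module.injective_module_of_injective_object R M
  have := Module.injective_of_isLocalizedModule S (Rₛ := Localization S)
    (M.localizedModuleMkLinearMap S)
  exact Module.injective_object_of_injective_module (Localization S) (M.localizedModule S)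

/-- Localizing the resolution termwise gives injectives again. Recording an equality of complexes,
not just an isomorphism, lets local cohomology over R_p be rewritten in terms of the original
resolution. -/
lemma nonempty_localizationFunctor_iso [IsNoetherianRing R] (p : PrimeSpectrum R)
    {X : DerivedCategory.Plus (ModuleCat.{u} R)}
    (L : CochainComplex.Plus (InjectiveObject (ModuleCat.{u} R)))
    (e : DerivedCategory.Plus.Q.obj
      ((InjectiveObject.ι (ModuleCat.{u} R)).mapCochainComplexPlus.obj L) ≅ X) :
    ∃ L' : CochainComplex.Plus (InjectiveObject (ModuleCat.{u} (Localization.AtPrime p.asIdeal))),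
      ((InjectiveObject.ι _).mapHomologicalComplex _).obj L'.obj =
        ((ModuleCat.localizedModuleFunctor.{u} p.asIdeal.primeCompl).mapHomologicalComplex _).obj
          (((InjectiveObject.ι (ModuleCat.{u} R)).mapHomologicalComplex _).obj L.obj) ∧
      Nonempty (DerivedCategory.Plus.Q.obj
        ((InjectiveObject.ι _).mapCochainComplexPlus.obj L') ≅ (localizationFunctor p).obj X) := by
  let I := ((InjectiveObject.ι (ModuleCat.{u} R)).mapHomologicalComplex (.up ℤ)).obj L.obj
  let F := ModuleCat.localizedModuleFunctor.{u} p.asIdeal.primeCompl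
  let L₀ : CochainComplex (InjectiveObject (ModuleCat.{u} (Localization.AtPrime p.asIdeal))) ℤ :=
    HomologicalComplex.liftObjectProperty
    (isInjective (ModuleCat.{u} (Localization.AtPrime p.asIdeal)))
    ((F.mapHomologicalComplex _).obj I) (fun n => by
      have : Injective (I.X n) := (L.obj.X n).property
      exact injective_localizedModuleFunctor_obj _ (I.X n))
  obtain ⟨n, hn⟩ := L.property
  have hL₀ : L₀.IsStrictlyGE n := by
    rw [← CochainComplex.isStrictlyGE_mapHomologicalComplex_obj_iff _ (InjectiveObject.ι _)]
    exact inferInstanceAs (CochainComplex.IsStrictlyGE ((F.mapHomologicalComplex _).obj I) n)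
  refine ⟨⟨L₀, n, hL₀⟩, rfl, ⟨?_⟩⟩
  refine DerivedCategory.Plus.ι.preimageIso ?_ ≪≫ (localizationFunctor p).mapIso e
  exact (F.mapDerivedCategoryFactors.app I).symm

lemma nonempty_localCohomologyAtPrime_iso [IsNoetherianRing R] (p : PrimeSpectrum R) (i : ℤ)
    {X : DerivedCategory.Plus (ModuleCat.{u} R)}
    (L : CochainComplex.Plus (InjectiveObject (ModuleCat.{u} R)))
    (e : DerivedCategory.Plus.Q.obj
      ((InjectiveObject.ι (ModuleCat.{u} R)).mapCochainComplexPlus.obj L) ≅ X) :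
    Nonempty (localCohomologyAtPrime p i X ≅
      (((localSectionsFunctor p).mapHomologicalComplex _).obj
        (((InjectiveObject.ι (ModuleCat.{u} R)).mapHomologicalComplex _).obj L.obj)).homology
          i) := by
  obtain ⟨L', hL', ⟨e'⟩⟩ := nonempty_localizationFunctor_iso p L e
  obtain ⟨e₁⟩ := nonempty_localCohomology_iso (PrimeSpectrum.zeroLocus
      (p.asIdeal.map (algebraMap R (Localization.AtPrime p.asIdeal)) :
        Set (Localization.AtPrime p.asIdeal))) i L' e'
  rw [hL'] at e₁
  exact ⟨(ModuleCat.restrictScalars _).mapIso e₁ ≪≫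
    (ShortComplex.mapHomologyIso (HomologicalComplex.sc _ i)
      (ModuleCat.restrictScalars (algebraMap R (Localization.AtPrime p.asIdeal)))).symm⟩

/-- Homology commutes with the exact functors used here: direct sum and evaluation at each p. -/
lemma nonempty_directSum_iso (T : Set (PrimeSpectrum R))
    (K : CochainComplex (ModuleCat.{u} R) ℤ) (i : ℤ) :
    Nonempty ((((localSectionsFamily T ⋙ directSumFunctor T).mapHomologicalComplex _).obj
      K).homology i ≅ ModuleCat.of R (⨁ p : T,
        ((((localSectionsFunctor p.1).mapHomologicalComplex _).obj K).homology i))) := by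
  let K' := ((localSectionsFamily T).mapHomologicalComplex _).obj K
  let e₁ : (((localSectionsFamily T ⋙ directSumFunctor T).mapHomologicalComplex _).obj
      K).homology i ≅ ModuleCat.of R (⨁ p : T, (K'.homology i).obj ⟨p⟩) :=
    ShortComplex.mapHomologyIso (K'.sc i) (directSumFunctor T)
  let e₂ (p : T) : (((localSectionsFunctor p.1).mapHomologicalComplex _).obj K).homology i ≅
      (K'.homology i).obj ⟨p⟩ :=
    ShortComplex.mapHomologyIso (K'.sc i)
      ((evaluation (Discrete T) (ModuleCat.{u} R)).obj ⟨p⟩)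
  exact ⟨e₁ ≪≫ (DFinsupp.mapRange.linearEquiv fun p => (e₂ p).symm.toLinearEquiv).toModuleIso⟩

lemma exact_conj {A B C A' B' C' : Type u} [AddCommGroup A] [AddCommGroup B] [AddCommGroup C]
    [AddCommGroup A'] [AddCommGroup B'] [AddCommGroup C'] [Module R A] [Module R B] [Module R C]
    [Module R A'] [Module R B'] [Module R C'] {f : A →ₗ[R] B} {g : B →ₗ[R] C}
    (h : Function.Exact f g) (a : A' ≃ₗ[R] A) (b : B' ≃ₗ[R] B) (c : C' ≃ₗ[R] C) :
    Function.Exact (b.symm.toLinearMap ∘ₗ f ∘ₗ a.toLinearMap)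
      (c.symm.toLinearMap ∘ₗ g ∘ₗ b.toLinearMap) := by
  intro x
  simp only [LinearMap.comp_apply, LinearEquiv.coe_coe, LinearEquiv.map_eq_zero_iff,
    Set.mem_range, LinearEquiv.symm_apply_eq]
  rw [h (b x), Set.mem_range]
  exact (a.surjective.exists (p := fun y => f y = b x))

end SupportedCohomology

open SupportedCohomology in
theorem lemma4p2 {R : Type u} [CommRing R] [IsNoetherianRing R]
    (Z Y : Set (PrimeSpectrum R))
    (hZ : StableUnderSpecialization Z) (hY : StableUnderSpecialization Y) (hZY : Z ⊆ Y)
    (hmin : ∀ p ∈ Y \ Z, PrimeSpectrum.zeroLocus (p.asIdeal : Set R) ∩ (Y \ Z) = {p})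
    (X : DerivedCategory.Plus (ModuleCat.{u} R)) :
    ∃ (f : ∀ i : ℤ, SupportedCohomology.localCohomology Z i X →ₗ[R]
          SupportedCohomology.localCohomology Y i X)
      (g : ∀ i : ℤ, SupportedCohomology.localCohomology Y i X →ₗ[R]
          ⨁ p : ↥(Y \ Z), SupportedCohomology.localCohomologyAtPrime p.1 i X)
      (δ : ∀ i : ℤ, (⨁ p : ↥(Y \ Z), SupportedCohomology.localCohomologyAtPrime p.1 i X) →ₗ[R]
          SupportedCohomology.localCohomology Z (i + 1) X),
      ∀ i : ℤ, Function.Exact (f i) (g i) ∧ Function.Exact (g i) (δ i) ∧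
        Function.Exact (δ i) (f (i + 1)) := by
  obtain ⟨n, hn⟩ : ∃ n : ℤ, X.IsGE n := by
    obtain ⟨n, hn⟩ := X.property
    exact ⟨n, (X.isGE_ι_obj_iff n).1 hn⟩
  obtain ⟨L, -, ⟨e⟩⟩ := X.exists_injective_nonempty_iso n
  let I := ((InjectiveObject.ι (ModuleCat.{u} R)).mapHomologicalComplex (.up ℤ)).obj L.obj
  have hI (n : ℤ) : Injective (I.X n) := (L.obj.X n).property
  let S : ShortComplex (CochainComplex (ModuleCat.{u} R) ℤ) :=
    { X₁ := ((sectionsFunctor Z).mapHomologicalComplex _).obj I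
      X₂ := ((sectionsFunctor Y).mapHomologicalComplex _).obj I
      X₃ := ((localSectionsFamily (Y \ Z) ⋙ directSumFunctor ↥(Y \ Z)).mapHomologicalComplex
        _).obj I
      f := (NatTrans.mapHomologicalComplex (sectionsInclusion hZY) _).app I
      g := (NatTrans.mapHomologicalComplex (sectionsToDirectSumNatTrans hZ hmin) _).app I
      zero := by
        ext n : 1
        exact congr_app (sectionsShortComplex hZ hmin hZY).zero (I.X n) }
  -- Exactness holds degreewise because every term of I is injective.
  have hS : S.ShortExact := HomologicalComplex.shortExact_of_degreewise_shortExact S fun n =>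
    sectionsShortComplex_shortExact hZ hmin hY hZY (I.X n)
  have eZ (i : ℤ) : localCohomology Z i X ≃ₗ[R] S.X₁.homology i :=
    (nonempty_localCohomology_iso Z i L e).some.toLinearEquiv
  have eY (i : ℤ) : localCohomology Y i X ≃ₗ[R] S.X₂.homology i :=
    (nonempty_localCohomology_iso Y i L e).some.toLinearEquiv
  have eD (i : ℤ) : (⨁ p : ↥(Y \ Z), localCohomologyAtPrime p.1 i X) ≃ₗ[R] S.X₃.homology i :=
    (DFinsupp.mapRange.linearEquiv fun p : ↥(Y \ Z) =>
      (nonempty_localCohomologyAtPrime_iso p.1 i L e).some.toLinearEquiv).trans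
      (nonempty_directSum_iso (Y \ Z) I i).some.symm.toLinearEquiv
  refine ⟨fun i => (eY i).symm.toLinearMap ∘ₗ (HomologicalComplex.homologyMap S.f i).hom ∘ₗ
      (eZ i).toLinearMap,
    fun i => (eD i).symm.toLinearMap ∘ₗ (HomologicalComplex.homologyMap S.g i).hom ∘ₗ
      (eY i).toLinearMap,
    fun i => (eZ (i + 1)).symm.toLinearMap ∘ₗ (hS.δ i (i + 1) rfl).hom ∘ₗ (eD i).toLinearMap,
    fun i => ⟨?_, ?_, ?_⟩⟩
  · exact exact_conj ((ShortComplex.ShortExact.moduleCat_exact_iff_function_exact _).1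
      (hS.homology_exact₂ i)) _ _ _
  · exact exact_conj ((ShortComplex.ShortExact.moduleCat_exact_iff_function_exact _).1
      (hS.homology_exact₃ i (i + 1) rfl)) _ _ _
  · exact exact_conj ((ShortComplex.ShortExact.moduleCat_exact_iff_function_exact _).1
      (hS.homology_exact₁ i (i + 1) rfl)) _ _ _
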